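/- Let $q$ agents and $d$ objects be given, let $\alpha>0$ and $K_1,\dots,K_d>0$, and let $\|\cdot\|$ be a norm on $\mathbb R^q$ whose canonical unit vectors all have norm $1$. For functions $f,g$ write $f\sim g$ if $f-g=o(g)$; that is, $f/g\to1$ when $g$ does not vanish, and $f=0$ eventually when $g=0$ eventually. *Claims.* Let $V=(V_1,\dots,V_d)^\top$ be a random vector with values in $[0,\infty)^d$ and $P(V_j>t)\sim K_jt^{-\alpha}$ as $t\to\infty$ for each $j$. A nonzero Radon measure $\nu$ on $[0,\infty]^d\setminus\{0\}$ is the exponent measure of $V$ if $n\,P(n^{-1/\alpha}V\in\cdot)\to\nu$ vaguely, i.e. for all integrals of continuous functions with compact support on $[0,\infty]^d\setminus\{0\}$. Call $V$ asymptotically independent if it has an exponent measure that has mass only on the coordinate axes, and asymptotically fully dependent if it has an exponent measure that has mass only on the half-line $\{s(K_1^{1/\alpha},\dots,K_d^{1/\alpha})^\top:s>0\}$. *Market.* Let $i\sim j$ denote the event that agent $i$ is linked to object $j$ in a random bipartite graph, let $W_{ij}\ge0$ be random weights, and put $A_{ij}=\mathbf 1(i\sim j)W_{ij}$, $A=(A_{ij})\in\mathbb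 R^{q\times d}$. The joint law of edges and weights is arbitrary (for example, edges independent with probabilities $p_{ij}$), except that $V$ is independent of $A$ and $\mathbb E A_{ij}^\alpha<\infty$ for all $i,j$. The exposures of the agents are $F=(F_1,\dots,F_q)^\top=AV$. Let $\mathrm{VaR}_{1-\gamma}(X)=\inf\{t\ge0:P(X>t)\le\gamma\}$ for $\gamma\in(0,1)$. With $K^{1/\alpha}=\mathrm{diag}(K_1^{1/\alpha},\dots,K_d^{1/\alpha})$ and $1=(1,\dots,1)^\top\in\mathbb R^d$, put $$C^i_{ind}=\sum_{j=1}^dK_j\,\mathbb E A_{ij}^\alpha,\qquad C^S_{ind}=\sum_{j=1}^dK_j\,\mathbb E\|Ae_j\|^\alpha,\qquad C^i_{dep}=\mathbb E\big[(AK^{1/\alpha}1)_i^\alpha\big],\qquad C^S_{dep}=\mathbb E\|AK^{1/\alpha}1\|^\alpha .$$ *Claim.* If $V$ is asymptotically independent, then as $\gamma\downarrow0$ $$\mathrm{VaR}_{1-\gamma}(F_i)\sim (C^i_{ind})^{1/\alpha}\gamma^{-1/\alpha}\quad(i=1,\dots,q),\qquad \mathrm{VaR}_{1-\gamma}(\|F\|)\sim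 (C^S_{ind})^{1/\alpha}\gamma^{-1/\alpha}.$$ If $V$ is asymptotically fully dependent, the same two relations hold with $C^i_{dep}$ and $C^S_{dep}$ in place of $C^i_{ind}$ and $C^S_{ind}$. -/

import Mathlib

open MeasureTheory ProbabilityTheory Filter Asymptotics
open scoped Topology ENNReal

namespace ReinsuranceMarket

noncomputable section

/-! ### Multivariate regular variation -/

/-- The punctured compactified orthant `[0,∞]^d \ {0}`. With the subspace topology, its compact
sets are the compact subsets of `[0,∞]^d` that do not contain the origin. -/
abbrev PuncturedOrthant (d : ℕ) : Type := {x : Fin d → ℝ≥0∞ // x ≠ 0}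

/-- The law of `X / b`, for a random vector `X` with values in `[0,∞)^d` and `b > 0`, as a measure
on `[0,∞]^d \ {0}` (the mass at the origin is discarded). -/
def scaledLaw {Ω : Type*} [MeasurableSpace Ω] {d : ℕ} (P : Measure Ω) (X : Ω → Fin d → ℝ)
    (b : ℝ) : Measure (PuncturedOrthant d) :=
  (P.map (fun ω (j : Fin d) => ENNReal.ofReal (X ω j / b))).comap Subtype.val

/-- Vague convergence of measures: convergence of the integrals of all continuous functions with
compact support. -/
def VagueTendsto {E : Type*} [TopologicalSpace E] [MeasurableSpace E]
    (μ : ℕ → Measure E) (ν : Measure E) : Prop :=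
  ∀ f : E → ℝ, Continuous f → HasCompactSupport f →
    Tendsto (fun n => ∫ x, f x ∂(μ n)) atTop (𝓝 (∫ x, f x ∂ν))

/-- `ν` is the exponent measure of `X` for the normalizing sequence `b`: a nonzero Radon measure on
`[0,∞]^d \ {0}` with `n P(X / b n ∈ ·) → ν` vaguely. (As `[0,∞]^d \ {0}` is locally compact and
second countable, a Borel measure on it is Radon iff it is finite on compact sets.) -/
structure IsExponentMeasure {Ω : Type*} [MeasurableSpace Ω] {d : ℕ} (P : Measure Ω)
    (X : Ω → Fin d → ℝ) (b : ℕ → ℝ) (ν : Measure (PuncturedOrthant d)) : Prop where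
  radon : IsFiniteMeasureOnCompacts ν
  ne_zero : ν ≠ 0
  tendsto : VagueTendsto (fun n : ℕ => (n : ℝ≥0∞) • scaledLaw P X (b n)) ν

/-- The union of the coordinate axes in `[0,∞]^d \ {0}`. -/
def axes (d : ℕ) : Set (PuncturedOrthant d) :=
  {x | ∃ j, ∀ k, k ≠ j → x.1 k = 0}

/-- The open half-line `{s K^{1/α} 1 : s > 0}`, where `K^{1/α} 1` is the vector with entries
`K j ^ (1/α)`. -/
def ray {d : ℕ} (K : Fin d → ℝ) (α : ℝ) : Set (PuncturedOrthant d) :=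
  {x | ∃ s : ℝ, 0 < s ∧ ∀ j, x.1 j = ENNReal.ofReal (s * K j ^ (1 / α))}

/-- The components of `V` are asymptotically independent: `V` is regularly varying, with
normalizing sequence `n^{1/α}`, and its exponent measure has mass only on the axes. -/
def AsymptoticallyIndependent {Ω : Type*} [MeasurableSpace Ω] {d : ℕ} (P : Measure Ω)
    (V : Ω → Fin d → ℝ) (α : ℝ) : Prop :=
  ∃ ν : Measure (PuncturedOrthant d),
    IsExponentMeasure P V (fun n => (n : ℝ) ^ (1 / α)) ν ∧ ν (axes d)ᶜ = 0

/-- `V` is asymptotically fully dependent: `V` is regularly varying, with normalizing sequence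
`n^{1/α}`, and its exponent measure has mass only on the half-line `{s K^{1/α} 1 : s > 0}`. -/
def AsymptoticallyFullyDependent {Ω : Type*} [MeasurableSpace Ω] {d : ℕ} (P : Measure Ω)
    (V : Ω → Fin d → ℝ) (K : Fin d → ℝ) (α : ℝ) : Prop :=
  ∃ ν : Measure (PuncturedOrthant d),
    IsExponentMeasure P V (fun n => (n : ℝ) ^ (1 / α)) ν ∧ ν (ray K α)ᶜ = 0

/-- Pareto tails: `P(V_j > t) ~ K_j t^{-α}` as `t → ∞`, for every `j`. -/
def HasParetoTails {Ω : Type*} [MeasurableSpace Ω] {d : ℕ} (P : Measure Ω)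
    (V : Ω → Fin d → ℝ) (K : Fin d → ℝ) (α : ℝ) : Prop :=
  ∀ j, (fun t : ℝ => P.real {ω | t < V ω j}) ~[atTop] (fun t : ℝ => K j * t ^ (-α))

/-! ### The market -/

/-- The weighted adjacency matrix `A_{ij} = 1(i ∼ j) W_{ij}` of a random bipartite graph on
`q` agents and `d` objects; `edge i j` is the event that agent `i` is linked to object `j`. -/
def weightedAdjacency {Ω : Type*} {q d : ℕ} (edge : Fin q → Fin d → Set Ω)
    (W : Fin q → Fin d → Ω → ℝ) (ω : Ω) : Matrix (Fin q) (Fin d) ℝ :=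
  Matrix.of fun i j => (edge i j).indicator (W i j) ω

/-- The vector of exposures `F = A V`. -/
def exposure {Ω : Type*} {q d : ℕ} (A : Ω → Matrix (Fin q) (Fin d) ℝ) (V : Ω → Fin d → ℝ)
    (ω : Ω) : Fin q → ℝ :=
  (A ω).mulVec (V ω)

/-- The Value-at-Risk at confidence level `1 - γ`:
`VaR_{1-γ}(X) = inf {t ≥ 0 : P(X > t) ≤ γ}`. -/
def VaR {Ω : Type*} [MeasurableSpace Ω] (P : Measure Ω) (X : Ω → ℝ) (level : ℝ) : ℝ :=
  sInf {t : ℝ | 0 ≤ t ∧ P.real {ω | t < X ω} ≤ 1 - level}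

/-- `C^i_ind = ∑_j K_j E A_{ij}^α`. -/
def individualConstInd {Ω : Type*} [MeasurableSpace Ω] {q d : ℕ} (P : Measure Ω)
    (A : Ω → Matrix (Fin q) (Fin d) ℝ) (K : Fin d → ℝ) (α : ℝ) (i : Fin q) : ℝ :=
  ∑ j, K j * ∫ ω, (A ω i j) ^ α ∂P

/-- `C^S_ind = ∑_j K_j E ‖A e_j‖^α`. -/
def systemConstInd {Ω : Type*} [MeasurableSpace Ω] {q d : ℕ} (P : Measure Ω)
    (A : Ω → Matrix (Fin q) (Fin d) ℝ) (K : Fin d → ℝ) (α : ℝ)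
    (N : Seminorm ℝ (Fin q → ℝ)) : ℝ :=
  ∑ j, K j * ∫ ω, (N ((A ω).mulVec (Pi.single j 1))) ^ α ∂P

/-- `C^i_dep = E (A K^{1/α} 1)_i^α`. -/
def individualConstDep {Ω : Type*} [MeasurableSpace Ω] {q d : ℕ} (P : Measure Ω)
    (A : Ω → Matrix (Fin q) (Fin d) ℝ) (K : Fin d → ℝ) (α : ℝ) (i : Fin q) : ℝ :=
  ∫ ω, ((A ω * Matrix.diagonal fun j => K j ^ (1 / α)).mulVec 1 i) ^ α ∂P

/-- `C^S_dep = E ‖A K^{1/α} 1‖^α`. -/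
def systemConstDep {Ω : Type*} [MeasurableSpace Ω] {q d : ℕ} (P : Measure Ω)
    (A : Ω → Matrix (Fin q) (Fin d) ℝ) (K : Fin d → ℝ) (α : ℝ)
    (N : Seminorm ℝ (Fin q → ℝ)) : ℝ :=
  ∫ ω, (N ((A ω * Matrix.diagonal fun j => K j ^ (1 / α)).mulVec 1)) ^ α ∂P

/-- `N` is a norm on `ℝ^q` for which all canonical unit vectors have norm `1`. -/
def IsNormalizedNorm {q : ℕ} (N : Seminorm ℝ (Fin q → ℝ)) : Prop :=
  (∀ x, N x = 0 → x = 0) ∧ ∀ i, N (Pi.single i 1) = 1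

end

end ReinsuranceMarket

open ReinsuranceMarket

/-!
The individual claim is the systemic claim for the seminorm `x ↦ |x i|`, because the exposures are
nonnegative; so everything is proved for a seminorm `N` of the exposures.

Fix the network first. Then `v ↦ N (a v)` is a seminorm `p` on the space of claims, and
`t^α P(p(V) > t)` has a limit. Under asymptotic independence, a continuous test function that
vanishes on the axes shows that two claims exceed `ε t` simultaneously with probability `o(t^{-α})`
(`AsymptoticallyIndependent.tendsto_joint_exceedance`). Off that event `p(V)` is within a small
multiple of `t` of `p(e_j) V_j` for the only large claim `V_j`, which gives the limit
`∑ K_j p(e_j)^α`. Under full dependence, a test function that vanishes on the ray shows that the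
claims `V_j / K_j^{1/α}` differ by more than `δ t` with probability `o(t^{-α})`
(`AsymptoticallyFullyDependent.tendsto_deviation`), so `p(V)` is close to a multiple of
`p(K^{1/α} 1)`, and the limit is `p(K^{1/α} 1)^α`. Of the exponent measure only its support is
used; the tail constants come from the Pareto marginals.

For a random network independent of `V`, condition on it and let the limit pass under the
expectation (`tendsto_tail_exposure`). Since `t^α P(V_j > t)` is bounded for all `t > 0`, the
conditional tails are dominated by a constant times `∑ N(A e_j)^α`, which the moments of order `α`
make integrable. Finally, a tail `C t^{-α}` with `C > 0` is inverted into the quantile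
`(C / γ)^{1/α}`. If `C = 0`, the asymptotic relation requires the Value-at-Risk to vanish, and it
does because `N(F) = 0` almost surely: nonnegativity of `A` rules out cancellation between its
columns.
-/

namespace ReinsuranceMarket

/-! ### Regularly varying tails on the real line -/

lemma tendsto_rpow_mul_comp_mul {G : ℝ → ℝ} {α L r : ℝ} (hr : 0 < r)
    (hG : Tendsto (fun t => t ^ α * G t) atTop (𝓝 L)) :
    Tendsto (fun t => t ^ α * G (r * t)) atTop (𝓝 (r ^ (-α) * L)) := by
  have h := (hG.comp (tendsto_id.const_mul_atTop hr)).const_mul (r ^ (-α))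
  refine h.congr' ?_
  filter_upwards [eventually_gt_atTop 0] with t ht
  simp only [Function.comp, id]
  rw [Real.mul_rpow hr.le ht.le, Real.rpow_neg hr.le]
  have : r ^ α ≠ 0 := (Real.rpow_pos_of_pos hr α).ne'
  field_simp

lemma tendsto_one_add_rpow_mul (α L : ℝ) :
    Tendsto (fun ε : ℝ => (1 + ε) ^ (-α) * L) (𝓝 0) (𝓝 L) := by
  have h : ContinuousAt (fun ε : ℝ => (1 + ε) ^ (-α) * L) 0 :=
    ((continuousAt_const.add continuousAt_id).rpow_const (Or.inl (by simp))).mul continuousAt_const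
  simpa using h.tendsto

/-- A tail that lies, up to negligible errors, between slight rescalings of a regularly varying
tail has the same limit. -/
lemma tendsto_rpow_mul_of_sandwich {G T : ℝ → ℝ} {α L : ℝ}
    (hT : Tendsto (fun t => t ^ α * T t) atTop (𝓝 L))
    (h : ∀ ε : ℝ, 0 < ε → ε < 1 → ∃ R : ℝ → ℝ, Tendsto (fun t => t ^ α * R t) atTop (𝓝 0) ∧
      ∀ᶠ t in atTop, G t ≤ T ((1 - ε) * t) + R t ∧ T ((1 + ε) * t) ≤ G t + R t) :
    Tendsto (fun t => t ^ α * G t) atTop (𝓝 L) := by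
  have hlim := tendsto_one_add_rpow_mul α L
  have hsmall : ∀ᶠ ε : ℝ in 𝓝[>] 0, ε < 1 :=
    nhdsWithin_le_nhds (eventually_lt_nhds zero_lt_one)
  rw [tendsto_order]
  refine ⟨fun a ha => ?_, fun a ha => ?_⟩
  · obtain ⟨ε, ⟨hε, hε1⟩, hε0⟩ := ((((hlim.mono_left nhdsWithin_le_nhds).eventually_const_lt ha).and
      hsmall).and (self_mem_nhdsWithin : Set.Ioi (0 : ℝ) ∈ 𝓝[>] 0)).exists
    obtain ⟨R, hR, hGR⟩ := h ε hε0 hε1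
    have h1 := (tendsto_rpow_mul_comp_mul (by linarith : 0 < 1 + ε) hT).sub hR
    rw [sub_zero] at h1
    filter_upwards [h1.eventually_const_lt hε, hGR, eventually_gt_atTop 0] with t h2 h3 ht
    have h4 := mul_le_mul_of_nonneg_left h3.2 (Real.rpow_pos_of_pos ht α).le
    linarith [mul_add (t ^ α) (G t) (R t)]
  · have hlim' : Tendsto (fun ε : ℝ => (1 - ε) ^ (-α) * L) (𝓝 0) (𝓝 L) := by
      have hneg : Tendsto (fun ε : ℝ => -ε) (𝓝 0) (𝓝 0) := by
        simpa using (continuous_neg (G := ℝ)).tendsto 0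
      simpa [sub_eq_add_neg, Function.comp_def] using hlim.comp hneg
    obtain ⟨ε, ⟨hε, hε1⟩, hε0⟩ := ((((hlim'.mono_left nhdsWithin_le_nhds).eventually_lt_const ha).and
      hsmall).and (self_mem_nhdsWithin : Set.Ioi (0 : ℝ) ∈ 𝓝[>] 0)).exists
    obtain ⟨R, hR, hGR⟩ := h ε hε0 hε1
    have h1 := (tendsto_rpow_mul_comp_mul (by linarith : 0 < 1 - ε) hT).add hR
    rw [add_zero] at h1
    filter_upwards [h1.eventually_lt_const hε, hGR, eventually_gt_atTop 0] with t h2 h3 ht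
    have h4 := mul_le_mul_of_nonneg_left h3.1 (Real.rpow_pos_of_pos ht α).le
    linarith [mul_add (t ^ α) (T ((1 - ε) * t)) (R t)]

/-- For a monotone tail, negligibility along the normalizing sequence `n ^ (1 / α)` implies
negligibility along all large `t`. -/
lemma tendsto_rpow_mul_zero_of_nat {h : ℝ → ℝ} {α : ℝ} (hα : 0 < α) (h0 : ∀ t, 0 ≤ h t)
    (hanti : ∀ s t, 0 < s → s ≤ t → h t ≤ h s)
    (hn : Tendsto (fun n : ℕ => (n : ℝ) * h ((n : ℝ) ^ (1 / α))) atTop (𝓝 0)) :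
    Tendsto (fun t => t ^ α * h t) atTop (𝓝 0) := by
  have h1 : Tendsto (fun t : ℝ => ⌊t ^ α⌋₊) atTop atTop :=
    tendsto_nat_floor_atTop.comp (tendsto_rpow_atTop hα)
  have h2 := (hn.comp h1).const_mul 2
  rw [mul_zero] at h2
  refine squeeze_zero' ?_ ?_ h2
  · filter_upwards [eventually_gt_atTop 0] with t ht
    exact mul_nonneg (Real.rpow_pos_of_pos ht α).le (h0 t)
  · filter_upwards [eventually_ge_atTop 1] with t ht
    have ht0 : 0 < t := by linarith
    have hge : 1 ≤ t ^ α := Real.one_le_rpow ht hα.le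
    have hfl : 1 ≤ ⌊t ^ α⌋₊ := Nat.le_floor (by simpa using hge)
    have hfl' : (1 : ℝ) ≤ ⌊t ^ α⌋₊ := by exact_mod_cast hfl
    have hlt : t ^ α < ⌊t ^ α⌋₊ + 1 := Nat.lt_floor_add_one _
    have hle : ((⌊t ^ α⌋₊ : ℝ)) ^ (1 / α) ≤ t := by
      calc ((⌊t ^ α⌋₊ : ℝ)) ^ (1 / α) ≤ (t ^ α) ^ (1 / α) :=
            Real.rpow_le_rpow (by positivity) (Nat.floor_le (by positivity)) (by positivity)
        _ = t := by rw [← Real.rpow_mul ht0.le, mul_one_div_cancel hα.ne', Real.rpow_one]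
    have hh := hanti _ t (Real.rpow_pos_of_pos (by linarith) _) hle
    simp only [Function.comp]
    calc t ^ α * h t ≤ (2 * ⌊t ^ α⌋₊) * h ((⌊t ^ α⌋₊ : ℝ) ^ (1 / α)) :=
          mul_le_mul (by linarith) hh (h0 t) (by positivity)
      _ = _ := by ring

/-! ### Inversion of the tail: Value-at-Risk -/

/-- The quantile of a random variable with tail `C t^{-α}`, `C > 0`, is asymptotic to
`(C / γ)^{1/α}`. -/
lemma VaR_isEquivalent_of_tail_pos {Ω : Type*} [MeasurableSpace Ω] {P : Measure Ω}
    [IsFiniteMeasure P] {α C : ℝ} (hα : 0 < α) (hC : 0 < C) {X : Ω → ℝ}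
    (hX : Tendsto (fun t => t ^ α * P.real {ω | t < X ω}) atTop (𝓝 C)) :
    (fun γ : ℝ => VaR P X (1 - γ)) ~[𝓝[>] 0] (fun γ : ℝ => C ^ (1 / α) * γ ^ (-1 / α)) := by
  set G : ℝ → ℝ := fun t => P.real {ω | t < X ω} with hG
  have hanti : ∀ s t, s ≤ t → G t ≤ G s := fun s t hst =>
    measureReal_mono (fun ω (hω : t < X ω) => lt_of_le_of_lt hst hω)
  have hc : 0 < C ^ (1 / α) := Real.rpow_pos_of_pos hC _
  -- `G (x C^{1/α} γ^{-1/α}) / γ → x^{-α}` for every `x > 0`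
  have key : ∀ x : ℝ, 0 < x → Tendsto (fun γ : ℝ => G (x * (C ^ (1 / α) * γ ^ (-1 / α))) / γ)
      (𝓝[>] 0) (𝓝 (x ^ (-α))) := by
    intro x hx
    have hb : Tendsto (fun γ : ℝ => C ^ (1 / α) * γ ^ (-1 / α)) (𝓝[>] 0) atTop := by
      refine Tendsto.const_mul_atTop hc ?_
      have := (tendsto_rpow_atTop (by positivity : 0 < 1 / α)).comp tendsto_inv_nhdsGT_zero
      refine this.congr' ?_
      filter_upwards [self_mem_nhdsWithin] with γ hγ
      have hγ' : (0 : ℝ) < γ := hγ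
      simp only [Function.comp]
      rw [Real.inv_rpow hγ'.le, ← Real.rpow_neg hγ'.le, neg_div]
    have h1 := ((tendsto_rpow_mul_comp_mul hx hX).comp hb).const_mul C⁻¹
    have h2 : C⁻¹ * (x ^ (-α) * C) = x ^ (-α) := by field_simp
    rw [h2] at h1
    refine h1.congr' ?_
    filter_upwards [self_mem_nhdsWithin] with γ hγ
    have hγ' : (0 : ℝ) < γ := hγ
    simp only [Function.comp]
    have h3 : (C ^ (1 / α) * γ ^ (-1 / α)) ^ α = C * γ⁻¹ := by
      rw [Real.mul_rpow hc.le (Real.rpow_pos_of_pos hγ' _).le, ← Real.rpow_mul hC.le,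
        ← Real.rpow_mul hγ'.le, one_div_mul_cancel hα.ne', div_mul_cancel₀ _ hα.ne',
        Real.rpow_one, Real.rpow_neg_one]
    rw [h3]
    field_simp
    rfl
  refine isEquivalent_of_tendsto_one ?_
  have hpos : ∀ᶠ γ : ℝ in 𝓝[>] 0, 0 < γ ∧ 0 < C ^ (1 / α) * γ ^ (-1 / α) := by
    filter_upwards [self_mem_nhdsWithin] with γ hγ
    exact ⟨hγ, mul_pos hc (Real.rpow_pos_of_pos hγ _)⟩
  have hupper : ∀ x : ℝ, 1 < x → ∀ᶠ γ : ℝ in 𝓝[>] 0,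
      G (x * (C ^ (1 / α) * γ ^ (-1 / α))) ≤ 1 - (1 - γ) := by
    intro x hx
    filter_upwards [(key x (by linarith)).eventually_lt_const
      (Real.rpow_lt_one_of_one_lt_of_neg hx (by linarith : -α < 0)), hpos] with γ h1 h2
    rw [div_lt_one h2.1] at h1
    linarith
  rw [tendsto_order]
  refine ⟨fun a ha => ?_, fun a ha => ?_⟩
  · obtain ⟨x, hx, hx1⟩ := exists_between (max_lt ha (zero_lt_one (α := ℝ)))
    have hx0 : 0 < x := (le_max_right _ _).trans_lt hx
    filter_upwards [(key x hx0).eventually_const_lt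
      (Real.one_lt_rpow_of_pos_of_lt_one_of_neg hx0 hx1 (by linarith : -α < 0)), hpos,
      hupper 2 one_lt_two] with γ h1 h2 h3
    rw [one_lt_div h2.1] at h1
    have hle : x * (C ^ (1 / α) * γ ^ (-1 / α)) ≤ VaR P X (1 - γ) := by
      refine le_csInf ⟨_, mul_nonneg zero_le_two h2.2.le, h3⟩ ?_
      rintro t ⟨-, ht⟩
      by_contra! hlt
      have h4 : G t ≤ 1 - (1 - γ) := ht
      linarith [hanti _ _ hlt.le]
    rw [Pi.div_apply, lt_div_iff₀ h2.2]
    refine lt_of_lt_of_le ?_ hle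
    exact mul_lt_mul_of_pos_right ((le_max_left _ _).trans_lt hx) h2.2
  · obtain ⟨x, hx1, hx⟩ := exists_between ha
    filter_upwards [hupper x hx1, hpos] with γ h1 h2
    have hle : VaR P X (1 - γ) ≤ x * (C ^ (1 / α) * γ ^ (-1 / α)) :=
      csInf_le ⟨0, fun t ht => ht.1⟩ ⟨mul_nonneg (by linarith) h2.2.le, h1⟩
    rw [Pi.div_apply, div_lt_iff₀ h2.2]
    exact hle.trans_lt (mul_lt_mul_of_pos_right hx h2.2)

/-- Quantile asymptotics including the degenerate constant `C = 0`, where the random variable must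
vanish for the relation to hold. -/
lemma VaR_isEquivalent_of_tail {Ω : Type*} [MeasurableSpace Ω] {P : Measure Ω}
    [IsFiniteMeasure P] {α C : ℝ} (hα : 0 < α) (hC : 0 ≤ C) {X : Ω → ℝ}
    (hX : Tendsto (fun t => t ^ α * P.real {ω | t < X ω}) atTop (𝓝 C))
    (hzero : C = 0 → ∀ᵐ ω ∂P, X ω = 0) :
    (fun γ : ℝ => VaR P X (1 - γ)) ~[𝓝[>] 0] (fun γ : ℝ => C ^ (1 / α) * γ ^ (-1 / α)) := by
  rcases hC.eq_or_lt with h | h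
  · have h0 := hzero h.symm
    refine EventuallyEq.isEquivalent ?_
    filter_upwards [self_mem_nhdsWithin] with γ hγ
    rw [← h, Real.zero_rpow (by positivity), zero_mul]
    have hmem : P.real {ω | 0 < X ω} = 0 := by
      have : P {ω | 0 < X ω} = 0 := by
        refine measure_mono_null ?_ (ae_iff.1 h0)
        exact fun ω (hω : 0 < X ω) => hω.ne'
      simp [Measure.real, this]
    refine le_antisymm (csInf_le ⟨0, fun t ht => ht.1⟩ ⟨le_rfl, ?_⟩)
      (Real.sInf_nonneg fun t ht => ht.1)
    rw [hmem]
    linarith [Set.mem_Ioi.1 hγ]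
  · exact VaR_isEquivalent_of_tail_pos hα h hX

section Claims

/-! ### Tails of a single claim -/

variable {Ω : Type*} [MeasurableSpace Ω] {P : Measure Ω} {d : ℕ}
  {V : Ω → Fin d → ℝ}

lemma HasParetoTails.tendsto {K : Fin d → ℝ} {α : ℝ} (hK : ∀ j, 0 < K j)
    (h : HasParetoTails P V K α) (j : Fin d) :
    Tendsto (fun t => t ^ α * P.real {ω | t < V ω j}) atTop (𝓝 (K j)) := by
  have hne : ∀ᶠ t : ℝ in atTop, K j * t ^ (-α) ≠ 0 := by
    filter_upwards [eventually_gt_atTop 0] with t ht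
    exact mul_ne_zero (hK j).ne' (Real.rpow_pos_of_pos ht _).ne'
  have h1 := ((isEquivalent_iff_tendsto_one hne).1 (h j)).const_mul (K j)
  rw [mul_one] at h1
  refine h1.congr' ?_
  filter_upwards [eventually_gt_atTop 0] with t ht
  have := (Real.rpow_pos_of_pos ht α).ne'
  have := (hK j).ne'
  rw [Pi.div_apply, Real.rpow_neg ht.le]
  field_simp

/-- Limiting tail of a multiple of a single claim. -/
lemma HasParetoTails.tendsto_const_mul {K : Fin d → ℝ} {α : ℝ} (hα : 0 < α) (hK : ∀ j, 0 < K j)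
    (h : HasParetoTails P V K α) (j : Fin d) {c : ℝ} (hc : 0 ≤ c) :
    Tendsto (fun t => t ^ α * P.real {ω | t < c * V ω j}) atTop (𝓝 (K j * c ^ α)) := by
  rcases hc.eq_or_lt with rfl | hc
  · rw [Real.zero_rpow hα.ne', mul_zero]
    refine tendsto_const_nhds.congr' ?_
    filter_upwards [eventually_ge_atTop 0] with t ht
    have : {ω | t < 0 * V ω j} = ∅ := by
      ext ω
      simpa using ht
    rw [this, measureReal_empty, mul_zero]
  · have h1 := tendsto_rpow_mul_comp_mul (inv_pos.2 hc) (h.tendsto hK j)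
    rw [Real.inv_rpow hc.le, ← Real.rpow_neg hc.le, neg_neg, mul_comm] at h1
    refine h1.congr fun t => ?_
    congr 2
    ext ω
    exact inv_mul_lt_iff₀ hc

/-! ### Consequences of vague convergence -/

lemma hasCompactSupport_comp_val {g : (Fin d → ℝ≥0∞) → ℝ} {j : Fin d} {c : ℝ≥0∞}
    (hc : 0 < c) (hg : ∀ x, g x ≠ 0 → c ≤ x j) :
    HasCompactSupport (fun x : PuncturedOrthant d => g x.1) := by
  refine HasCompactSupport.intro (K := {x : PuncturedOrthant d | c ≤ x.1 j}) ?_ ?_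
  · rw [Subtype.isCompact_iff]
    have : Subtype.val '' {x : PuncturedOrthant d | c ≤ x.1 j} = {x : Fin d → ℝ≥0∞ | c ≤ x j} := by
      ext x
      constructor
      · rintro ⟨y, hy, rfl⟩
        exact hy
      · intro hx
        refine ⟨⟨x, ?_⟩, hx, rfl⟩
        rintro rfl
        exact hc.not_ge hx
    rw [this]
    exact (isClosed_le continuous_const (continuous_apply j)).isCompact
  · intro x hx
    by_contra h
    exact hx (hg x.1 h)

variable [IsProbabilityMeasure P]

/-- If the exponent measure is carried by `S`, then an event that a nonnegative test function
vanishing on `S` can detect has probability `o(1 / n)`. -/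
lemma IsExponentMeasure.tendsto_mul_measureReal_zero {ν : Measure (PuncturedOrthant d)}
    {b : ℕ → ℝ} (hV : Measurable V) (hν : IsExponentMeasure P V b ν)
    {S : Set (PuncturedOrthant d)} (hS : ν Sᶜ = 0) {g : (Fin d → ℝ≥0∞) → ℝ}
    (hgc : Continuous g) (hg0 : ∀ x, 0 ≤ g x) (hgS : ∀ x ∈ S, g x.1 = 0) {j : Fin d} {c : ℝ≥0∞}
    (hc : 0 < c) (hg : ∀ x, g x ≠ 0 → c ≤ x j) :
    Tendsto (fun n : ℕ => (n : ℝ) *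
      P.real {ω | 1 ≤ g (fun k => ENNReal.ofReal (V ω k / b n))}) atTop (𝓝 0) := by
  set f : PuncturedOrthant d → ℝ := fun x => g x.1 with hf
  have hfc : Continuous f := hgc.comp continuous_subtype_val
  have hfs : HasCompactSupport f := hasCompactSupport_comp_val hc hg
  have h1 := hν.tendsto f hfc hfs
  have h2 : ∫ x, f x ∂ν = 0 := by
    refine integral_eq_zero_of_ae ?_
    refine measure_mono_null (fun x hx => ?_) hS
    exact fun hxS => hx (hgS x hxS)
  rw [h2] at h1
  refine squeeze_zero (fun n => by positivity) (fun n => ?_) h1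
  have hms : MeasurableSet {x : Fin d → ℝ≥0∞ | x ≠ 0} := (measurableSet_singleton 0).compl
  have hemb : MeasurableEmbedding (Subtype.val : PuncturedOrthant d → Fin d → ℝ≥0∞) :=
    MeasurableEmbedding.subtype_coe hms
  have hmeas : Measurable (fun ω (k : Fin d) => ENNReal.ofReal (V ω k / b n)) := by
    refine measurable_pi_lambda _ fun k => ?_
    exact (((measurable_pi_apply k).comp hV).div_const _).ennreal_ofReal
  have hE : MeasurableSet {x : PuncturedOrthant d | 1 ≤ f x} :=
    (isClosed_le continuous_const hfc).measurableSet
  have hlaw : scaledLaw P V (b n) {x : PuncturedOrthant d | 1 ≤ f x}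
      = P {ω | 1 ≤ g (fun k => ENNReal.ofReal (V ω k / b n))} := by
    rw [scaledLaw, hemb.comap_apply,
      Measure.map_apply hmeas (hemb.measurableSet_image' hE)]
    congr 1
    ext ω
    constructor
    · rintro ⟨x, hx, hxω⟩
      have hx' : 1 ≤ g x.1 := hx
      rw [hxω] at hx'
      exact hx'
    · intro h
      have h' : 1 ≤ g (fun k => ENNReal.ofReal (V ω k / b n)) := h
      refine ⟨⟨_, ?_⟩, h', rfl⟩
      intro h0
      have := hg _ (by linarith : g (fun k => ENNReal.ofReal (V ω k / b n)) ≠ 0)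
      have h0j : ENNReal.ofReal (V ω j / b n) = 0 := congrFun h0 j
      exact hc.not_ge (this.trans h0j.le)
  have : IsFiniteMeasure (scaledLaw P V (b n)) := by
    have := Measure.isFiniteMeasure_map P (fun ω (k : Fin d) => ENNReal.ofReal (V ω k / b n))
    unfold scaledLaw
    infer_instance
  have hint : Integrable f (scaledLaw P V (b n)) := hfc.integrable_of_hasCompactSupport hfs
  rw [integral_smul_measure, ENNReal.toReal_natCast, smul_eq_mul]
  refine mul_le_mul_of_nonneg_left ?_ (Nat.cast_nonneg n)
  rw [Measure.real, ← hlaw, ← Measure.real]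
  simpa using mul_meas_ge_le_integral_of_nonneg 
    (Eventually.of_forall fun x : PuncturedOrthant d => hg0 x.1) hint 1

/-- The truncation `min x M` as a real-valued function on `[0,∞]`. -/
noncomputable def truncReal (M : ℝ) (x : ℝ≥0∞) : ℝ := (min x (ENNReal.ofReal M)).toReal

lemma continuous_truncReal (M : ℝ) : Continuous (truncReal M) := by
  refine ENNReal.continuousOn_toReal.comp_continuous (continuous_id.min continuous_const) ?_
  intro x
  exact ne_top_of_le_ne_top ENNReal.ofReal_ne_top (min_le_right _ _)

lemma truncReal_nonneg (M : ℝ) (x : ℝ≥0∞) : 0 ≤ truncReal M x := ENNReal.toReal_nonneg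

lemma truncReal_zero (M : ℝ) : truncReal M 0 = 0 := by simp [truncReal]

lemma truncReal_ofReal {M y : ℝ} (hM : 0 ≤ M) (hy : 0 ≤ y) :
    truncReal M (ENNReal.ofReal y) = min y M := by
  rw [truncReal, ← ENNReal.ofReal_min, ENNReal.toReal_ofReal (le_min hy hM)]

lemma ofReal_le_of_le_truncReal {M c : ℝ} {x : ℝ≥0∞} (h : c ≤ truncReal M x) :
    ENNReal.ofReal c ≤ x :=
  (ENNReal.ofReal_le_ofReal h).trans
    ((ENNReal.ofReal_toReal_le).trans (min_le_left _ _))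

lemma natCast_rpow_one_div_pos {α : ℝ} {n : ℕ} (hn : 0 < n) : 0 < (n : ℝ) ^ (1 / α) :=
  Real.rpow_pos_of_pos (by exact_mod_cast hn) _

/-- Asymptotic independence makes it negligible that two claims are large at once. -/
lemma AsymptoticallyIndependent.tendsto_joint_exceedance {α : ℝ} (hα : 0 < α) (hV : Measurable V)
    (h : AsymptoticallyIndependent P V α) {j k : Fin d} (hjk : j ≠ k)
    {ε : ℝ} (hε : 0 < ε) :
    Tendsto (fun t => t ^ α * P.real {ω | ε * t < V ω j ∧ ε * t < V ω k}) atTop (𝓝 0) := by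
  obtain ⟨ν, hν, hax⟩ := h
  refine tendsto_rpow_mul_zero_of_nat hα (fun t => measureReal_nonneg) ?_ ?_
  · intro s t hs hst
    refine measureReal_mono ?_
    rintro ω ⟨h1, h2⟩
    have := mul_le_mul_of_nonneg_left hst hε.le
    exact ⟨by linarith, by linarith⟩
  · set g : (Fin d → ℝ≥0∞) → ℝ := fun x =>
      max 0 (2 / ε * min (truncReal ε (x j)) (truncReal ε (x k)) - 1) with hg
    have hlim := hν.tendsto_mul_measureReal_zero hV hax (g := g) (j := j)
      (c := ENNReal.ofReal (ε / 2)) ?_ (fun x => le_max_left _ _) ?_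
      (by rw [ENNReal.ofReal_pos]; linarith) ?_
    · refine squeeze_zero' (Eventually.of_forall fun n => by positivity) ?_ hlim
      filter_upwards [eventually_gt_atTop 0] with n hn
      have hb : 0 < (n : ℝ) ^ (1 / α) := natCast_rpow_one_div_pos hn
      refine mul_le_mul_of_nonneg_left (measureReal_mono ?_) (Nat.cast_nonneg n)
      rintro ω ⟨h1, h2⟩
      rw [← lt_div_iff₀ hb] at h1 h2
      have e : ∀ i, ε < V ω i / (n : ℝ) ^ (1 / α) →
          truncReal ε (ENNReal.ofReal (V ω i / (n : ℝ) ^ (1 / α))) = ε := fun i hi => by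
        rw [truncReal_ofReal hε.le (hε.le.trans hi.le), min_eq_right hi.le]
      simp only [hg, Set.mem_ofPred_eq, e j h1, e k h2, min_self]
      rw [div_mul_cancel₀ _ hε.ne']
      norm_num
    · have hj := (continuous_truncReal ε).comp (continuous_apply (A := fun _ : Fin d => ℝ≥0∞) j)
      have hk := (continuous_truncReal ε).comp (continuous_apply (A := fun _ : Fin d => ℝ≥0∞) k)
      exact continuous_const.max ((continuous_const.mul (hj.min hk)).sub continuous_const)
    · rintro x ⟨i, hi⟩
      have : min (truncReal ε (x.1 j)) (truncReal ε (x.1 k)) = 0 := by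
        by_cases hij : j = i
        · rw [hi k (fun h => hjk (hij.trans h.symm)), truncReal_zero]
          exact min_eq_right (truncReal_nonneg _ _)
        · rw [hi j hij, truncReal_zero]
          exact min_eq_left (truncReal_nonneg _ _)
      simp [hg, this]
    · intro x hx
      have h1 : 0 < 2 / ε * min (truncReal ε (x j)) (truncReal ε (x k)) - 1 := by
        by_contra! h2
        exact hx (max_eq_left h2)
      refine ofReal_le_of_le_truncReal (M := ε) ?_
      refine le_trans ?_ (min_le_left _ (truncReal ε (x k)))
      rw [div_mul_eq_mul_div, sub_pos, lt_div_iff₀ hε] at h1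
      linarith

/-- Under full dependence the claims are asymptotically proportional to `K^{1/α}`. -/
lemma AsymptoticallyFullyDependent.tendsto_deviation {K : Fin d → ℝ} {α : ℝ} (hα : 0 < α)
    (hK : ∀ j, 0 < K j) (hV : Measurable V) (hV0 : ∀ ω j, 0 ≤ V ω j)
    (hP : HasParetoTails P V K α) (h : AsymptoticallyFullyDependent P V K α) (j k : Fin d)
    {δ : ℝ} (hδ : 0 < δ) :
    Tendsto (fun t => t ^ α * P.real {ω | δ * t < V ω j / K j ^ (1 / α) - V ω k / K k ^ (1 / α)})
      atTop (𝓝 0) := by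
  obtain ⟨ν, hν, hray⟩ := h
  have hu : ∀ i, 0 < K i ^ (1 / α) := fun i => Real.rpow_pos_of_pos (hK i) _
  set u : Fin d → ℝ := fun i => K i ^ (1 / α) with hu_def
  refine tendsto_rpow_mul_zero_of_nat hα (fun t => measureReal_nonneg) ?_ ?_
  · intro s t hs hst
    refine measureReal_mono fun ω h1 => ?_
    have := mul_le_mul_of_nonneg_left hst hδ.le
    exact lt_of_le_of_lt this h1
  -- below the level `M`, the deviation is seen by a test function vanishing on the ray
  have htrunc : ∀ M : ℝ, 0 < M → Tendsto (fun n : ℕ => (n : ℝ) * P.real {ω |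
      δ * (n : ℝ) ^ (1 / α) < V ω j / u j - V ω k / u k ∧ V ω j / u j ≤ M * (n : ℝ) ^ (1 / α)})
      atTop (𝓝 0) := by
    intro M hM
    set g : (Fin d → ℝ≥0∞) → ℝ := fun x => max 0 (2 / δ * (truncReal (M * u j) (x j) / u j -
      truncReal (M * u k) (x k) / u k) - 1) with hg
    have hlim := hν.tendsto_mul_measureReal_zero hV hray (g := g) (j := j)
      (c := ENNReal.ofReal (δ / 2 * u j)) ?_ (fun x => le_max_left _ _) ?_
      (by rw [ENNReal.ofReal_pos]; have := hu j; positivity) ?_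
    · refine squeeze_zero' (Eventually.of_forall fun n => by positivity) ?_ hlim
      filter_upwards [eventually_gt_atTop 0] with n hn
      have hb : 0 < (n : ℝ) ^ (1 / α) := natCast_rpow_one_div_pos hn
      refine mul_le_mul_of_nonneg_left (measureReal_mono ?_) (Nat.cast_nonneg n)
      rintro ω ⟨h1, h2⟩
      set β := (n : ℝ) ^ (1 / α) with hβ
      have e : ∀ i, truncReal (M * u i) (ENNReal.ofReal (V ω i / β)) / u i
          = min (V ω i / u i / β) M := fun i => by
        rw [truncReal_ofReal (mul_pos hM (hu i)).le (div_nonneg (hV0 ω i) hb.le),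
          ← min_div_div_right (hu i).le, mul_div_cancel_right₀ _ (hu i).ne', div_right_comm]
      simp only [hg, Set.mem_ofPred_eq, e]
      refine le_max_of_le_right ?_
      have h3 : V ω j / u j / β ≤ M := (div_le_iff₀ hb).2 h2
      have h4 : δ < V ω j / u j / β - V ω k / u k / β := by
        rw [← sub_div, lt_div_iff₀ hb]; exact h1
      have h5 : δ ≤ min (V ω j / u j / β) M - min (V ω k / u k / β) M := by
        rw [min_eq_left h3]
        linarith [min_le_left (V ω k / u k / β) M]
      have h6 : 2 / δ * δ ≤ 2 / δ * (min (V ω j / u j / β) M - min (V ω k / u k / β) M) :=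
        mul_le_mul_of_nonneg_left h5 (by positivity)
      rw [div_mul_cancel₀ _ hδ.ne'] at h6
      linarith
    · have hc : ∀ i, Continuous fun x : Fin d → ℝ≥0∞ => truncReal (M * u i) (x i) / u i :=
        fun i => ((continuous_truncReal _).comp (continuous_apply i)).div_const _
      exact continuous_const.max ((continuous_const.mul ((hc j).sub (hc k))).sub continuous_const)
    · rintro x ⟨s, hs, hx⟩
      have e : ∀ i, truncReal (M * u i) (x.1 i) / u i = min s M := fun i => by
        rw [hx i, truncReal_ofReal (mul_pos hM (hu i)).le (mul_pos hs (hu i)).le,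
          ← min_div_div_right (hu i).le, mul_div_cancel_right₀ _ (hu i).ne',
          mul_div_cancel_right₀ _ (hu i).ne']
      simp [hg, e]
    · intro x hx
      have h1 : 0 < 2 / δ * (truncReal (M * u j) (x j) / u j -
          truncReal (M * u k) (x k) / u k) - 1 := by
        by_contra! h2
        exact hx (max_eq_left h2)
      refine ofReal_le_of_le_truncReal (M := M * u j) ?_
      rw [div_mul_eq_mul_div, sub_pos, lt_div_iff₀ hδ] at h1
      have h2 : 0 ≤ truncReal (M * u k) (x k) / u k :=
        div_nonneg (truncReal_nonneg _ _) (hu k).le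
      rw [← le_div_iff₀ (hu j)]
      linarith
  -- exceedances of the level `M` contribute at most `M^{-α}` in the limit
  have hbig : ∀ M : ℝ, 0 < M → Tendsto (fun n : ℕ => (n : ℝ) * P.real {ω |
      M * (n : ℝ) ^ (1 / α) < V ω j / u j}) atTop (𝓝 (M ^ (-α))) := by
    intro M hM
    have h1 := tendsto_rpow_mul_comp_mul hM
      (hP.tendsto_const_mul hα hK j (inv_nonneg.2 (hu j).le))
    have h2 : K j * (K j ^ (1 / α))⁻¹ ^ α = 1 := by
      rw [Real.inv_rpow (hu j).le, ← Real.rpow_mul (hK j).le, one_div_mul_cancel hα.ne',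
        Real.rpow_one, mul_inv_cancel₀ (hK j).ne']
    rw [h2, mul_one] at h1
    have hb : Tendsto (fun n : ℕ => (n : ℝ) ^ (1 / α)) atTop atTop :=
      (tendsto_rpow_atTop (by positivity : 0 < 1 / α)).comp tendsto_natCast_atTop_atTop
    refine (h1.comp hb).congr fun n => ?_
    simp only [Function.comp]
    rw [← Real.rpow_mul (Nat.cast_nonneg n), one_div_mul_cancel hα.ne', Real.rpow_one]
    simp only [inv_mul_eq_div, hu_def]
  have hM0 : Tendsto (fun M : ℝ => M ^ (-α)) atTop (𝓝 0) := tendsto_rpow_neg_atTop hα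
  rw [tendsto_order]
  refine ⟨fun a ha => Eventually.of_forall fun n => ha.trans_le (by positivity), fun a ha => ?_⟩
  obtain ⟨M, hMa, hM⟩ := ((hM0.eventually_lt_const ha).and (eventually_gt_atTop 0)).exists
  have hsum := (htrunc M hM).add (hbig M hM)
  rw [zero_add] at hsum
  filter_upwards [hsum.eventually_lt_const hMa] with n hn
  refine lt_of_le_of_lt ?_ hn
  rw [← mul_add]
  refine mul_le_mul_of_nonneg_left ?_ (Nat.cast_nonneg n)
  refine le_trans (measureReal_mono ?_) (measureReal_union_le _ _)
  intro ω hω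
  by_cases hle : V ω j / u j ≤ M * (n : ℝ) ^ (1 / α)
  · exact Or.inl ⟨hω, hle⟩
  · exact Or.inr (not_le.1 hle)

end Claims

/-! ### Seminorms on finite-dimensional coordinate spaces -/

section Seminorms

variable {n : ℕ}

lemma seminorm_le_sum (p : Seminorm ℝ (Fin n → ℝ)) (x : Fin n → ℝ) :
    p x ≤ ∑ i, |x i| * p (Pi.single i 1) := by
  conv_lhs => rw [pi_eq_sum_univ' x]
  refine (Finset.le_sum_of_subadditive p (map_zero p).le (map_add_le_add p) _ _).trans ?_
  refine Finset.sum_le_sum fun i _ => ?_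
  rw [map_smul_eq_mul, Real.norm_eq_abs]

lemma continuous_seminorm (p : Seminorm ℝ (Fin n → ℝ)) : Continuous p := by
  refine Seminorm.continuous_of_continuousAt_zero ?_
  rw [ContinuousAt, map_zero]
  have h : Continuous fun x : Fin n → ℝ => ∑ i, |x i| * p (Pi.single i 1) := by fun_prop
  have h0 := h.tendsto 0
  simp only [Pi.zero_apply, abs_zero, zero_mul, Finset.sum_const_zero] at h0
  exact squeeze_zero (fun x => apply_nonneg p x) (seminorm_le_sum p) h0

lemma sum_rpow_le_sum_rpow {x : Fin n → ℝ} (hx : ∀ i, 0 ≤ x i) {α : ℝ} (hα : 0 < α) :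
    (∑ i, x i) ^ α ≤ ∑ i, (n * x i) ^ α := by
  have hnn : ∀ i, 0 ≤ (n * x i) ^ α := fun i =>
    Real.rpow_nonneg (mul_nonneg (Nat.cast_nonneg n) (hx i)) α
  rcases isEmpty_or_nonempty (Fin n) with h | h
  · simp [Real.zero_rpow hα.ne']
  · obtain ⟨m, hm⟩ := Finite.exists_max x
    have h1 : ∑ i, x i ≤ n * x m := by
      simpa using Finset.sum_le_card_nsmul Finset.univ x (x m) fun i _ => hm i
    exact (Real.rpow_le_rpow (Finset.sum_nonneg fun i _ => hx i) h1 hα.le).trans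
      (Finset.single_le_sum (f := fun i => (n * x i) ^ α) (fun i _ => hnn i) (Finset.mem_univ m))

/-- A vector with a single large coordinate has nearly the seminorm of that coordinate. -/
lemma abs_seminorm_sub_single_le (p : Seminorm ℝ (Fin n → ℝ)) {v : Fin n → ℝ} (hv : ∀ i, 0 ≤ v i)
    (j : Fin n) {s : ℝ} (hs : 0 ≤ s) (h : ∀ i, i ≠ j → v i ≤ s) :
    |p v - p (Pi.single j 1) * v j| ≤ s * ∑ i, p (Pi.single i 1) := by
  have h1 : p (Pi.single j 1) * v j = p (v j • Pi.single j 1) := by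
    rw [map_smul_eq_mul, Real.norm_eq_abs, abs_of_nonneg (hv j), mul_comm]
  rw [h1, Finset.mul_sum]
  refine (abs_sub_map_le_sub p _ _).trans ((seminorm_le_sum p _).trans ?_)
  refine Finset.sum_le_sum fun i _ => mul_le_mul_of_nonneg_right ?_ (apply_nonneg p _)
  by_cases hij : i = j
  · subst hij; simpa using hs
  · simpa [hij, abs_of_nonneg (hv i)] using h i hij

end Seminorms

/-! ### Tails of a seminorm of the claims -/

section SeminormTails

variable {Ω : Type*} [MeasurableSpace Ω] {P : Measure Ω} [IsProbabilityMeasure P] {d : ℕ}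
  {V : Ω → Fin d → ℝ} {K : Fin d → ℝ} {α : ℝ}

lemma HasParetoTails.exists_bound (hα : 0 < α) (hK : ∀ j, 0 < K j) (h : HasParetoTails P V K α) :
    ∃ M : ℝ, 0 ≤ M ∧ ∀ j, ∀ t : ℝ, 0 < t → t ^ α * P.real {ω | t < V ω j} ≤ M := by
  have h1 : ∀ᶠ t : ℝ in atTop, ∀ j, t ^ α * P.real {ω | t < V ω j} ≤ K j + 1 :=
    eventually_all.2 fun j => ((h.tendsto hK j).eventually_lt_const (lt_add_one _)).mono
      fun t ht => ht.le
  obtain ⟨t₀, ht₀⟩ := eventually_atTop.1 (h1.and (eventually_ge_atTop 0))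
  have ht0 : 0 ≤ t₀ := (ht₀ t₀ le_rfl).2
  have hKs : 0 ≤ ∑ j, (K j + 1) := Finset.sum_nonneg fun j _ => by linarith [hK j]
  have htα := Real.rpow_nonneg ht0 α
  refine ⟨t₀ ^ α + ∑ j, (K j + 1), by positivity, fun j t ht => ?_⟩
  rcases le_total t t₀ with hle | hle
  · calc t ^ α * P.real {ω | t < V ω j} ≤ t ^ α * 1 :=
          mul_le_mul_of_nonneg_left measureReal_le_one (Real.rpow_nonneg ht.le α)
      _ ≤ t₀ ^ α := by rw [mul_one]; exact Real.rpow_le_rpow ht.le hle hα.le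
      _ ≤ _ := by linarith
  · have := Finset.single_le_sum (f := fun j => K j + 1) (fun j _ => by linarith [hK j])
      (Finset.mem_univ j)
    have := (ht₀ t hle).1 j
    linarith

/-- The uniform tail bound that serves as a dominating function after conditioning on the network.
As the Pareto tails are bounded by a pure power for all `t > 0`, the moment of order exactly `α`
is enough. -/
lemma rpow_mul_tail_seminorm_le {M : ℝ} (hM : 0 ≤ M)
    (hb : ∀ j, ∀ t : ℝ, 0 < t → t ^ α * P.real {ω | t < V ω j} ≤ M)
    (hV0 : ∀ ω j, 0 ≤ V ω j) (p : Seminorm ℝ (Fin d → ℝ)) {t : ℝ} (ht : 0 < t) :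
    t ^ α * P.real {ω | t < p (V ω)} ≤ ∑ j, M * (d * p (Pi.single j 1)) ^ α := by
  have hsub : {ω | t < p (V ω)} ⊆
      ⋃ j ∈ (Finset.univ : Finset (Fin d)), {ω | t < d * p (Pi.single j 1) * V ω j} := by
    intro ω hω
    by_contra hcon
    simp only [Finset.mem_univ, Set.iUnion_true, Set.mem_iUnion, not_exists] at hcon
    have hle : ∀ j, d * p (Pi.single j 1) * V ω j ≤ t := fun j => not_lt.1 (hcon j)
    have h1 : p (V ω) ≤ ∑ j, p (Pi.single j 1) * V ω j := by
      refine (seminorm_le_sum p _).trans (le_of_eq (Finset.sum_congr rfl fun j _ => ?_))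
      rw [abs_of_nonneg (hV0 ω j), mul_comm]
    have hω' : t < p (V ω) := hω
    have h2 : (d : ℝ) * ∑ j, p (Pi.single j 1) * V ω j ≤ d * t := by
      rw [Finset.mul_sum]
      simpa [mul_assoc] using Finset.sum_le_card_nsmul Finset.univ _ t fun j _ => hle j
    rcases Nat.eq_zero_or_pos d with hd | hd
    · subst hd
      simp at h1
      linarith
    · have := le_of_mul_le_mul_left h2 (by exact_mod_cast hd : (0 : ℝ) < d)
      linarith
  have htα := Real.rpow_pos_of_pos ht α
  calc t ^ α * P.real {ω | t < p (V ω)}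
      ≤ t ^ α * ∑ j, P.real {ω | t < d * p (Pi.single j 1) * V ω j} :=
        mul_le_mul_of_nonneg_left ((measureReal_mono hsub (measure_ne_top _ _)).trans
          (measureReal_biUnion_finset_le _ _)) htα.le
    _ = ∑ j, t ^ α * P.real {ω | t < d * p (Pi.single j 1) * V ω j} := Finset.mul_sum _ _ _
    _ ≤ _ := by
        refine Finset.sum_le_sum fun j _ => ?_
        have hc : 0 ≤ d * p (Pi.single j 1) := mul_nonneg (Nat.cast_nonneg d) (apply_nonneg p _)
        set c := d * p (Pi.single j 1)
        rcases hc.eq_or_lt with h0 | hc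
        · have : {ω | t < c * V ω j} = ∅ := by
            ext ω
            simpa [← h0] using ht.le
          rw [this, measureReal_empty, mul_zero]
          exact mul_nonneg hM (Real.rpow_nonneg h0.le _)
        · have h1 := mul_le_mul_of_nonneg_right (hb j (t / c) (div_pos ht hc))
            (Real.rpow_pos_of_pos hc α).le
          rw [Real.div_rpow ht.le hc.le] at h1
          have h2 : {ω | t / c < V ω j} = {ω | t < c * V ω j} := by
            ext ω
            exact div_lt_iff₀' hc
          rw [h2] at h1
          have := (Real.rpow_pos_of_pos hc α).ne'
          calc _ = t ^ α / c ^ α * P.real {ω | t < c * V ω j} * c ^ α := by field_simp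
            _ ≤ _ := h1

/-- The principle of one large jump: under asymptotic independence, a seminorm of the claims is
large only because a single claim is. -/
lemma AsymptoticallyIndependent.tendsto_seminorm (hα : 0 < α) (hK : ∀ j, 0 < K j)
    (hV : Measurable V) (hV0 : ∀ ω j, 0 ≤ V ω j) (hP : HasParetoTails P V K α)
    (h : AsymptoticallyIndependent P V α) (p : Seminorm ℝ (Fin d → ℝ)) :
    Tendsto (fun t => t ^ α * P.real {ω | t < p (V ω)}) atTop
      (𝓝 (∑ j, K j * p (Pi.single j 1) ^ α)) := by
  have hVm : ∀ j, Measurable fun ω => V ω j := fun j => (measurable_pi_apply j).comp hV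
  have hT : Tendsto (fun t => t ^ α * ∑ j, P.real {ω | t < p (Pi.single j 1) * V ω j}) atTop
      (𝓝 (∑ j, K j * p (Pi.single j 1) ^ α)) := by
    simp only [Finset.mul_sum]
    exact tendsto_finsetSum _ fun j _ => hP.tendsto_const_mul hα hK j (apply_nonneg p _)
  refine tendsto_rpow_mul_of_sandwich hT fun ε hε hε1 => ?_
  set S : ℝ := ∑ j, p (Pi.single j 1) with hS
  have hS0 : 0 ≤ S := Finset.sum_nonneg fun j _ => apply_nonneg p _
  set η : ℝ := ε / (S + 1) with hη
  have hη0 : 0 < η := by positivity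
  have hηS : η * S ≤ ε := by
    rw [hη, div_mul_eq_mul_div, div_le_iff₀ (by positivity)]
    nlinarith
  set E : ℝ → Fin d × Fin d → Set Ω := fun t x => {ω | η * t < V ω x.1 ∧ η * t < V ω x.2} with hE
  set U : ℝ → Set Ω := fun t => ⋃ x ∈ (Finset.univ : Finset (Fin d)).offDiag, E t x with hU
  have hUm : ∀ t, MeasurableSet (U t) := fun t => Finset.measurableSet_biUnion _ fun x _ =>
    (measurableSet_lt measurable_const (hVm x.1)).inter
      (measurableSet_lt measurable_const (hVm x.2))
  have hUle : ∀ t, P.real (U t) ≤ ∑ x ∈ (Finset.univ : Finset (Fin d)).offDiag, P.real (E t x) :=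
    fun t => measureReal_biUnion_finset_le _ _
  -- outside `U t`, at most one claim exceeds `η t`
  have hother : ∀ t ω, ω ∉ U t → ∀ j, η * t < V ω j → ∀ i, i ≠ j → V ω i ≤ η * t := by
    intro t ω hω j hj i hij
    by_contra! hi
    refine hω (Set.mem_biUnion (x := (i, j)) ?_ ⟨hi, hj⟩)
    simp [hij]
  have hclose : ∀ t, 0 < t → ∀ ω, ω ∉ U t → ∀ j, η * t < V ω j →
      |p (V ω) - p (Pi.single j 1) * V ω j| ≤ ε * t := by
    intro t ht ω hω j hj
    refine (abs_seminorm_sub_single_le p (hV0 ω) j (by positivity) (hother t ω hω j hj)).trans ?_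
    nlinarith
  refine ⟨fun t => (d + 1) * ∑ x ∈ (Finset.univ : Finset (Fin d)).offDiag, P.real (E t x),
    ?_, ?_⟩
  · have h1 : Tendsto (fun t => ∑ x ∈ (Finset.univ : Finset (Fin d)).offDiag,
        t ^ α * P.real (E t x)) atTop (𝓝 (∑ x ∈ (Finset.univ : Finset (Fin d)).offDiag, 0)) :=
      tendsto_finsetSum _ fun x hx =>
        h.tendsto_joint_exceedance hα hV (Finset.mem_offDiag.1 hx).2.2 hη0
    have h2 := h1.const_mul ((d : ℝ) + 1)
    rw [Finset.sum_const_zero, mul_zero] at h2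
    refine h2.congr fun t => ?_
    rw [← Finset.mul_sum]
    ring
  · filter_upwards [eventually_gt_atTop 0] with t ht
    have hR : 0 ≤ ∑ x ∈ (Finset.univ : Finset (Fin d)).offDiag, P.real (E t x) :=
      Finset.sum_nonneg fun x _ => measureReal_nonneg
    constructor
    · have hsub : {ω | t < p (V ω)} ⊆ (⋃ j ∈ (Finset.univ : Finset (Fin d)),
          {ω | (1 - ε) * t < p (Pi.single j 1) * V ω j}) ∪ U t := by
        intro ω hω
        have hω' : t < p (V ω) := hω
        by_cases hωU : ω ∈ U t
        · exact Or.inr hωU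
        refine Or.inl ?_
        have hex : ∃ j, η * t < V ω j := by
          by_contra! hcon
          have h1 : p (V ω) ≤ ∑ j, η * t * p (Pi.single j 1) := by
            refine (seminorm_le_sum p _).trans (Finset.sum_le_sum fun j _ => ?_)
            rw [abs_of_nonneg (hV0 ω j)]
            exact mul_le_mul_of_nonneg_right (hcon j) (apply_nonneg p _)
          rw [← Finset.mul_sum] at h1
          nlinarith
        obtain ⟨j, hj⟩ := hex
        refine Set.mem_biUnion (x := j) (Finset.mem_coe.2 (Finset.mem_univ j)) ?_
        have h1 := (abs_le.1 (hclose t ht ω hωU j hj)).2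
        simp only [Set.mem_ofPred_eq]
        linarith
      have h1 := (measureReal_mono hsub (μ := P)).trans (measureReal_union_le _ _)
      have h2 := measureReal_biUnion_finset_le (μ := P) (Finset.univ : Finset (Fin d))
        (fun j => {ω | (1 - ε) * t < p (Pi.single j 1) * V ω j})
      have h3 : (0 : ℝ) ≤ d * ∑ x ∈ (Finset.univ : Finset (Fin d)).offDiag, P.real (E t x) :=
        mul_nonneg (Nat.cast_nonneg d) hR
      linarith [hUle t]
    · set B : Fin d → Set Ω := fun j => {ω | (1 + ε) * t < p (Pi.single j 1) * V ω j} with hB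
      have hBm : ∀ j, MeasurableSet (B j) := fun j =>
        measurableSet_lt measurable_const ((hVm j).const_mul _)
      have hBV : ∀ j, ∀ ω ∈ B j, η * t < V ω j := by
        intro j ω hω
        have hω' : (1 + ε) * t < p (Pi.single j 1) * V ω j := hω
        by_contra! hcon
        have h1 : p (Pi.single j 1) ≤ S :=
          Finset.single_le_sum (f := fun j => p (Pi.single j (1 : ℝ)))
            (fun i _ => apply_nonneg p _) (Finset.mem_univ j)
        have h2 : p (Pi.single j 1) * V ω j ≤ S * (η * t) :=
          mul_le_mul h1 hcon (hV0 ω j) hS0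
        nlinarith
      have hdisj : (↑(Finset.univ : Finset (Fin d)) : Set (Fin d)).PairwiseDisjoint
          (fun j => B j \ U t) := by
        intro j _ k _ hjk
        refine Set.disjoint_left.2 fun ω h1 h2 => ?_
        exact absurd (hBV j ω h1.1)
          (not_lt.2 (hother t ω h2.2 k (hBV k ω h2.1) j hjk))
      have hsub : (⋃ j ∈ (Finset.univ : Finset (Fin d)), B j \ U t) ⊆ {ω | t < p (V ω)} := by
        intro ω hω
        simp only [Finset.mem_univ, Set.iUnion_true, Set.mem_iUnion] at hω
        obtain ⟨j, hj, hjU⟩ := hω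
        have h1 := (abs_le.1 (hclose t ht ω hjU j (hBV j ω hj))).1
        have h2 : (1 + ε) * t < p (Pi.single j 1) * V ω j := hj
        simp only [Set.mem_ofPred_eq]
        linarith
      have h1 := measureReal_mono hsub (μ := P)
      rw [measureReal_biUnion_finset hdisj fun j _ => (hBm j).diff (hUm t)] at h1
      have h2 : ∀ j, P.real (B j) ≤ P.real (B j \ U t) + P.real (U t) := fun j =>
        (measureReal_mono (Set.subset_sdiff_union _ _)).trans (measureReal_union_le _ _)
      have h3 := Finset.sum_le_sum fun j (_ : j ∈ (Finset.univ : Finset (Fin d))) => h2 j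
      rw [Finset.sum_add_distrib, Finset.sum_const, Finset.card_univ, Fintype.card_fin,
        nsmul_eq_mul] at h3
      have h4 := mul_le_mul_of_nonneg_left (hUle t) (Nat.cast_nonneg (α := ℝ) d)
      linarith

/-- Under full dependence, a seminorm of the claims behaves like that of a random multiple of the
vector `K^{1/α}`. -/
lemma AsymptoticallyFullyDependent.tendsto_seminorm (hα : 0 < α) (hK : ∀ j, 0 < K j)
    (hV : Measurable V) (hV0 : ∀ ω j, 0 ≤ V ω j) (hP : HasParetoTails P V K α)
    (h : AsymptoticallyFullyDependent P V K α) (p : Seminorm ℝ (Fin d → ℝ)) :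
    Tendsto (fun t => t ^ α * P.real {ω | t < p (V ω)}) atTop
      (𝓝 (p (fun j => K j ^ (1 / α)) ^ α)) := by
  -- without objects there would be no nonzero exponent measure
  have hne : Nonempty (Fin d) := by
    by_contra hcon
    rw [not_nonempty_iff] at hcon
    obtain ⟨ν, hν, -⟩ := h
    have : IsEmpty (PuncturedOrthant d) := ⟨fun x => x.2 (Subsingleton.elim _ _)⟩
    exact hν.ne_zero (Measure.eq_zero_of_isEmpty ν)
  obtain ⟨o⟩ := hne
  have hu : ∀ i, 0 < K i ^ (1 / α) := fun i => Real.rpow_pos_of_pos (hK i) _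
  set u : Fin d → ℝ := fun i => K i ^ (1 / α) with hu_def
  have hu' : ∀ i, 0 < u i := hu
  have hT := hP.tendsto_const_mul hα hK o (div_nonneg (apply_nonneg p u) (hu' o).le)
  have hconst : K o * (p u / u o) ^ α = p u ^ α := by
    rw [Real.div_rpow (apply_nonneg p u) (hu' o).le]
    have : u o ^ α = K o := by
      rw [hu_def, ← Real.rpow_mul (hK o).le, one_div_mul_cancel hα.ne', Real.rpow_one]
    rw [this, mul_div_cancel₀ _ (hK o).ne']
  rw [hconst] at hT
  refine tendsto_rpow_mul_of_sandwich (T := fun t => P.real {ω | t < p u / u o * V ω o}) hT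
    fun ε hε hε1 => ?_
  set S : ℝ := ∑ j, u j * p (Pi.single j 1) with hS
  have hS0 : 0 ≤ S := Finset.sum_nonneg fun j _ => mul_nonneg (hu' j).le (apply_nonneg p _)
  set δ : ℝ := ε / (S + 1) with hδ
  have hδ0 : 0 < δ := by positivity
  have hδS : δ * S ≤ ε := by
    rw [hδ, div_mul_eq_mul_div, div_le_iff₀ (by positivity)]
    nlinarith
  set E : ℝ → Fin d → Set Ω := fun t j => {ω | δ * t < V ω j / u j - V ω o / u o} ∪
    {ω | δ * t < V ω o / u o - V ω j / u j} with hE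
  set U : ℝ → Set Ω := fun t => ⋃ j ∈ (Finset.univ : Finset (Fin d)), E t j with hU
  have hclose : ∀ t, ∀ ω, ω ∉ U t → |p (V ω) - p u / u o * V ω o| ≤ ε * t := by
    intro t ω hω
    have hj : ∀ j, |V ω j / u j - V ω o / u o| ≤ δ * t := by
      intro j
      by_contra! hcon
      refine hω (Set.mem_biUnion (x := j) (Finset.mem_coe.2 (Finset.mem_univ j)) ?_)
      rcases lt_abs.1 hcon with h1 | h1
      · exact Or.inl h1
      · exact Or.inr (by rwa [neg_sub] at h1)
    have ht : 0 ≤ t := by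
      have := (abs_nonneg _).trans (hj o)
      exact nonneg_of_mul_nonneg_right this hδ0
    have h1 : p u / u o * V ω o = p ((V ω o / u o) • u) := by
      rw [map_smul_eq_mul, Real.norm_eq_abs, abs_of_nonneg (div_nonneg (hV0 ω o) (hu' o).le)]
      ring
    rw [h1]
    refine (abs_sub_map_le_sub p _ _).trans ((seminorm_le_sum p _).trans ?_)
    calc ∑ j, |(V ω - (V ω o / u o) • u) j| * p (Pi.single j 1)
        ≤ ∑ j, δ * t * (u j * p (Pi.single j 1)) := by
          refine Finset.sum_le_sum fun j _ => ?_
          rw [← mul_assoc]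
          refine mul_le_mul_of_nonneg_right ?_ (apply_nonneg p _)
          have h2 : (V ω - (V ω o / u o) • u) j = (V ω j / u j - V ω o / u o) * u j := by
            simp only [Pi.sub_apply, Pi.smul_apply, smul_eq_mul]
            rw [sub_mul, div_mul_cancel₀ _ (hu' j).ne']
          rw [h2, abs_mul, abs_of_pos (hu' j)]
          exact mul_le_mul_of_nonneg_right (hj j) (hu' j).le
      _ = δ * S * t := by rw [← Finset.mul_sum, ← hS]; ring
      _ ≤ ε * t := mul_le_mul_of_nonneg_right hδS ht
  refine ⟨fun t => P.real (U t), ?_, ?_⟩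
  · have h1 : Tendsto (fun t => ∑ j : Fin d,
        (t ^ α * P.real {ω | δ * t < V ω j / u j - V ω o / u o} +
          t ^ α * P.real {ω | δ * t < V ω o / u o - V ω j / u j})) atTop
        (𝓝 (∑ j : Fin d, (0 + 0))) :=
      tendsto_finsetSum _ fun j _ => (h.tendsto_deviation hα hK hV hV0 hP j o hδ0).add
        (h.tendsto_deviation hα hK hV hV0 hP o j hδ0)
    rw [add_zero, Finset.sum_const_zero] at h1
    refine squeeze_zero' ?_ ?_ h1
    · filter_upwards [eventually_ge_atTop 0] with t ht
      exact mul_nonneg (Real.rpow_nonneg ht α) measureReal_nonneg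
    · filter_upwards [eventually_ge_atTop 0] with t ht
      simp only [← mul_add]
      rw [← Finset.mul_sum]
      refine mul_le_mul_of_nonneg_left ?_ (Real.rpow_nonneg ht α)
      exact (measureReal_biUnion_finset_le _ _).trans
        (Finset.sum_le_sum fun j _ => measureReal_union_le _ _)
  · refine Eventually.of_forall fun t => ⟨?_, ?_⟩
    · refine (measureReal_mono fun ω hω => ?_).trans (measureReal_union_le _ _)
      by_cases hωU : ω ∈ U t
      · exact Or.inr hωU
      · have h1 := (abs_le.1 (hclose t ω hωU)).2
        have hω' : t < p (V ω) := hω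
        exact Or.inl (by simp only [Set.mem_ofPred_eq]; linarith)
    · refine (measureReal_mono fun ω hω => ?_).trans (measureReal_union_le _ _)
      by_cases hωU : ω ∈ U t
      · exact Or.inr hωU
      · have h1 := (abs_le.1 (hclose t ω hωU)).1
        have hω' : (1 + ε) * t < p u / u o * V ω o := hω
        exact Or.inl (by simp only [Set.mem_ofPred_eq]; linarith)

end SeminormTails

/-! ### Passing to the random network -/

section Network

variable {Ω : Type*} [MeasurableSpace Ω] {P : Measure Ω} {q d : ℕ}
  {V : Ω → Fin d → ℝ} {A : Ω → Matrix (Fin q) (Fin d) ℝ} {K : Fin d → ℝ} {α : ℝ}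

lemma mulVec_apply_nonneg {a : Matrix (Fin q) (Fin d) ℝ} {v : Fin d → ℝ} {i : Fin q}
    (ha : ∀ j, 0 ≤ a i j) (hv : ∀ j, 0 ≤ v j) : 0 ≤ a.mulVec v i := by
  simp only [Matrix.mulVec, dotProduct]
  exact Finset.sum_nonneg fun j _ => mul_nonneg (ha j) (hv j)

lemma measurable_seminorm_mulVec (N : Seminorm ℝ (Fin q → ℝ)) :
    Measurable fun x : (Fin q → Fin d → ℝ) × (Fin d → ℝ) =>
      N ((Matrix.of x.1).mulVec x.2) := by
  have h : Continuous fun x : (Fin q → Fin d → ℝ) × (Fin d → ℝ) =>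
      (Matrix.of x.1).mulVec x.2 := by
    refine continuous_pi fun i => ?_
    simp only [Matrix.mulVec, dotProduct, Matrix.of_apply]
    fun_prop
  exact ((continuous_seminorm N).comp h).measurable

/-- The seminorm `v ↦ N (a v)` that a fixed network `a` induces on the claims. -/
noncomputable def networkSeminorm (N : Seminorm ℝ (Fin q → ℝ)) (a : Matrix (Fin q) (Fin d) ℝ) :
    Seminorm ℝ (Fin d → ℝ) :=
  N.comp a.mulVecLin

lemma networkSeminorm_apply (N : Seminorm ℝ (Fin q → ℝ)) (a : Matrix (Fin q) (Fin d) ℝ)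
    (v : Fin d → ℝ) : networkSeminorm N a v = N (a.mulVec v) := rfl

lemma measurable_networkSeminorm (N : Seminorm ℝ (Fin q → ℝ))
    (hA : Measurable fun ω i j => A ω i j) (v : Fin d → ℝ) :
    Measurable fun ω => networkSeminorm N (A ω) v :=
  (measurable_seminorm_mulVec N).comp (hA.prodMk (measurable_const (a := v)))

/-- Integrability of `N (A v)^α`, from the moments of order `α` of the entries of `A`. -/
lemma integrable_networkSeminorm_rpow (N : Seminorm ℝ (Fin q → ℝ)) (hα : 0 < α)
    (hA : Measurable fun ω i j => A ω i j) (hA0 : ∀ ω i j, 0 ≤ A ω i j)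
    (hAα : ∀ i j, Integrable (fun ω => A ω i j ^ α) P) {v : Fin d → ℝ} (hv : ∀ j, 0 ≤ v j) :
    Integrable (fun ω => networkSeminorm N (A ω) v ^ α) P := by
  have hbound : Integrable (fun ω => ∑ i, ∑ j, (q * (d * (v j * N (Pi.single i 1)))) ^ α *
      A ω i j ^ α) P :=
    integrable_finsetSum _ fun i _ => integrable_finsetSum _ fun j _ => (hAα i j).const_mul _
  refine hbound.mono' ((measurable_networkSeminorm N hA v).pow_const α).aestronglyMeasurable ?_
  refine Eventually.of_forall fun ω => ?_
  rw [Real.norm_of_nonneg (Real.rpow_nonneg (apply_nonneg _ _) _)]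
  have hN : ∀ i, 0 ≤ N (Pi.single i 1) := fun i => apply_nonneg N _
  have hrow : ∀ i, 0 ≤ (A ω).mulVec v i := fun i =>
    mulVec_apply_nonneg (hA0 ω i) hv
  have hle : networkSeminorm N (A ω) v ≤ ∑ i, (A ω).mulVec v i * N (Pi.single i 1) := by
    refine (seminorm_le_sum N _).trans (le_of_eq (Finset.sum_congr rfl fun i _ => ?_))
    rw [Matrix.mulVecLin_apply, abs_of_nonneg (hrow i)]
  refine (Real.rpow_le_rpow (apply_nonneg _ _) hle hα.le).trans ((sum_rpow_le_sum_rpow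
    (fun i => mul_nonneg (hrow i) (hN i)) hα).trans (Finset.sum_le_sum fun i _ => ?_))
  have h1 : (q : ℝ) * ((A ω).mulVec v i * N (Pi.single i 1)) =
      ∑ j, q * (A ω i j * (v j * N (Pi.single i 1))) := by
    rw [← Finset.mul_sum]
    simp only [Matrix.mulVec, dotProduct, Finset.sum_mul, mul_assoc]
  have hnn : ∀ j, 0 ≤ v j * N (Pi.single i 1) := fun j => mul_nonneg (hv j) (hN i)
  rw [h1]
  refine (sum_rpow_le_sum_rpow (fun j => mul_nonneg (Nat.cast_nonneg q)
    (mul_nonneg (hA0 ω i j) (hnn j))) hα).trans (le_of_eq (Finset.sum_congr rfl fun j _ => ?_))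
  rw [← Real.mul_rpow (by have := hnn j; positivity) (hA0 ω i j)]
  congr 1
  ring

variable [IsProbabilityMeasure P]

/-- Breiman's theorem for the exposures: if for every fixed network the tail of the induced
seminorm of the claims has a limit, then the tail for an independent random network converges to
the mean of these limits. -/
lemma tendsto_tail_exposure (N : Seminorm ℝ (Fin q → ℝ)) (hα : 0 < α) (hK : ∀ j, 0 < K j)
    (hV : Measurable V) (hV0 : ∀ ω j, 0 ≤ V ω j) (hP : HasParetoTails P V K α)
    (hA : Measurable fun ω i j => A ω i j) (hA0 : ∀ ω i j, 0 ≤ A ω i j)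
    (hAα : ∀ i j, Integrable (fun ω => A ω i j ^ α) P)
    (hindep : IndepFun V (fun ω i j => A ω i j) P) {ℓ : Seminorm ℝ (Fin d → ℝ) → ℝ}
    (hℓ : ∀ p : Seminorm ℝ (Fin d → ℝ),
      Tendsto (fun t => t ^ α * P.real {ω | t < p (V ω)}) atTop (𝓝 (ℓ p))) :
    Tendsto (fun t => t ^ α * P.real {ω | t < N (exposure A V ω)}) atTop
      (𝓝 (∫ ω, ℓ (networkSeminorm N (A ω)) ∂P)) := by
  obtain ⟨M, hM, hb⟩ := hP.exists_bound hα hK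
  have hset : ∀ t : ℝ, MeasurableSet {x : (Fin q → Fin d → ℝ) × (Fin d → ℝ) |
      t < N ((Matrix.of x.1).mulVec x.2)} := fun t =>
    measurableSet_lt measurable_const (measurable_seminorm_mulVec N)
  have hsec : ∀ (t : ℝ) (a : Fin q → Fin d → ℝ), P.map V (Prod.mk a ⁻¹'
      {x : (Fin q → Fin d → ℝ) × (Fin d → ℝ) | t < N ((Matrix.of x.1).mulVec x.2)}) =
      P {ω | t < networkSeminorm N (Matrix.of a) (V ω)} := fun t a => by
    rw [Measure.map_apply hV (measurable_prodMk_left (hset t))]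
    rfl
  have hmeas : ∀ t : ℝ, Measurable fun ω => P {ω' | t < networkSeminorm N (A ω) (V ω')} := by
    intro t
    have hfin : IsProbabilityMeasure (P.map V) := Measure.isProbabilityMeasure_map hV.aemeasurable
    have h1 := (measurable_measure_prodMk_left (ν := P.map V) (hset t)).comp hA
    simp only [Function.comp_def, hsec] at h1
    exact h1
  -- conditioning on the network
  have hcond : ∀ t : ℝ, P.real {ω | t < N (exposure A V ω)} =
      ∫ ω, P.real {ω' | t < networkSeminorm N (A ω) (V ω')} ∂P := by
    intro t
    have hfin : IsProbabilityMeasure (P.map V) := Measure.isProbabilityMeasure_map hV.aemeasurable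
    have hfin' : IsProbabilityMeasure (P.map fun ω i j => A ω i j) :=
      Measure.isProbabilityMeasure_map hA.aemeasurable
    have hprod := (indepFun_iff_map_prod_eq_prod_map_map hA.aemeasurable hV.aemeasurable).1
      hindep.symm
    have h1 : P {ω | t < N (exposure A V ω)} =
        ∫⁻ ω, P {ω' | t < networkSeminorm N (A ω) (V ω')} ∂P := by
      calc P {ω | t < N (exposure A V ω)}
          = P.map (fun ω => ((fun i j => A ω i j), V ω)) {x | t < N ((Matrix.of x.1).mulVec x.2)} :=
            (Measure.map_apply (hA.prodMk hV) (hset t)).symm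
        _ = ∫⁻ a, P {ω | t < networkSeminorm N (Matrix.of a) (V ω)}
              ∂(P.map fun ω i j => A ω i j) := by
            rw [hprod, Measure.prod_apply (hset t)]
            exact lintegral_congr fun a => hsec t a
        _ = _ := by
            have h2 : Measurable fun a : Fin q → Fin d → ℝ =>
                P {ω | t < networkSeminorm N (Matrix.of a) (V ω)} := by
              have h3 := measurable_measure_prodMk_left (ν := P.map V) (hset t)
              simp only [hsec] at h3
              exact h3
            exact lintegral_map h2 hA
    rw [Measure.real, h1]
    exact (integral_toReal (hmeas t).aemeasurable
      (Eventually.of_forall fun ω => measure_lt_top _ _)).symm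
  simp only [hcond, ← integral_const_mul]
  refine tendsto_integral_filter_of_dominated_convergence
    (fun ω => ∑ j, M * (d * networkSeminorm N (A ω) (Pi.single j 1)) ^ α) ?_ ?_ ?_ ?_
  · exact Eventually.of_forall fun t =>
      ((hmeas t).ennreal_toReal.const_mul (t ^ α)).aestronglyMeasurable
  · filter_upwards [eventually_gt_atTop 0] with t ht
    refine Eventually.of_forall fun ω => ?_
    rw [Real.norm_of_nonneg (mul_nonneg (Real.rpow_nonneg ht.le α) measureReal_nonneg)]
    exact rpow_mul_tail_seminorm_le hM hb hV0 _ ht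
  · refine integrable_finsetSum _ fun j _ => Integrable.const_mul ?_ M
    have h1 := (integrable_networkSeminorm_rpow N hα hA hA0 hAα (v := Pi.single j 1)
      (fun k => by rw [Pi.single_apply]; split_ifs <;> norm_num)).const_mul ((d : ℝ) ^ α)
    refine h1.congr (Eventually.of_forall fun ω => ?_)
    exact (Real.mul_rpow (Nat.cast_nonneg d) (apply_nonneg _ _)).symm
  · exact Eventually.of_forall fun ω => hℓ _

/-- The asymptotically independent case for an arbitrary seminorm of the exposures. -/
lemma VaR_exposure_of_independent (N : Seminorm ℝ (Fin q → ℝ)) (hα : 0 < α) (hK : ∀ j, 0 < K j)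
    (hV : Measurable V) (hV0 : ∀ ω j, 0 ≤ V ω j) (hP : HasParetoTails P V K α)
    (hA : Measurable fun ω i j => A ω i j) (hA0 : ∀ ω i j, 0 ≤ A ω i j)
    (hAα : ∀ i j, Integrable (fun ω => A ω i j ^ α) P)
    (hindep : IndepFun V (fun ω i j => A ω i j) P) (h : AsymptoticallyIndependent P V α) :
    (fun γ : ℝ => VaR P (fun ω => N (exposure A V ω)) (1 - γ)) ~[𝓝[>] 0]
      (fun γ : ℝ => systemConstInd P A K α N ^ (1 / α) * γ ^ (-1 / α)) := by
  have hlim := tendsto_tail_exposure N hα hK hV hV0 hP hA hA0 hAα hindep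
    (h.tendsto_seminorm hα hK hV hV0 hP)
  have hint : ∀ j, Integrable (fun ω => networkSeminorm N (A ω) (Pi.single j 1) ^ α) P := fun j =>
    integrable_networkSeminorm_rpow N hα hA hA0 hAα
      (fun k => by rw [Pi.single_apply]; split_ifs <;> norm_num)
  have hnn : ∀ j ω, 0 ≤ networkSeminorm N (A ω) (Pi.single j 1) ^ α := fun j ω =>
    Real.rpow_nonneg (apply_nonneg _ _) _
  have hC : ∫ ω, ∑ j, K j * networkSeminorm N (A ω) (Pi.single j 1) ^ α ∂P =
      systemConstInd P A K α N := by
    rw [integral_finsetSum _ fun j _ => (hint j).const_mul (K j)]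
    simp only [integral_const_mul]
    rfl
  have hterm : ∀ j, 0 ≤ K j * ∫ ω, networkSeminorm N (A ω) (Pi.single j 1) ^ α ∂P := fun j =>
    mul_nonneg (hK j).le (integral_nonneg (hnn j))
  rw [hC] at hlim
  refine VaR_isEquivalent_of_tail hα (Finset.sum_nonneg fun j _ => hterm j) hlim fun h0 => ?_
  have h1 : ∀ j, ∀ᵐ ω ∂P, networkSeminorm N (A ω) (Pi.single j 1) = 0 := by
    intro j
    have h2 := (Finset.sum_eq_zero_iff_of_nonneg fun j _ => hterm j).1 h0 j (Finset.mem_univ j)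
    have h3 := (mul_eq_zero.1 h2).resolve_left (hK j).ne'
    filter_upwards [(integral_eq_zero_iff_of_nonneg (hnn j) (hint j)).1 h3] with ω hω
    exact (Real.rpow_eq_zero (apply_nonneg _ _) hα.ne').1 hω
  filter_upwards [ae_all_iff.2 h1] with ω hω
  refine le_antisymm ?_ (apply_nonneg _ _)
  refine (seminorm_le_sum (networkSeminorm N (A ω)) (V ω)).trans (le_of_eq ?_)
  simp [hω]

/-- The asymptotically fully dependent case for a seminorm of the exposures. The hypothesis `hN`
excludes cancellation between the columns of the network; it holds for norms and for the absolute
value of a coordinate. -/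
lemma VaR_exposure_of_fullyDependent (N : Seminorm ℝ (Fin q → ℝ))
    (hN : ∀ a : Matrix (Fin q) (Fin d) ℝ, (∀ i j, 0 ≤ a i j) → ∀ u : Fin d → ℝ, (∀ j, 0 < u j) →
      N (a.mulVec u) = 0 → ∀ v, N (a.mulVec v) = 0)
    (hα : 0 < α) (hK : ∀ j, 0 < K j)
    (hV : Measurable V) (hV0 : ∀ ω j, 0 ≤ V ω j) (hP : HasParetoTails P V K α)
    (hA : Measurable fun ω i j => A ω i j) (hA0 : ∀ ω i j, 0 ≤ A ω i j)
    (hAα : ∀ i j, Integrable (fun ω => A ω i j ^ α) P)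
    (hindep : IndepFun V (fun ω i j => A ω i j) P) (h : AsymptoticallyFullyDependent P V K α) :
    (fun γ : ℝ => VaR P (fun ω => N (exposure A V ω)) (1 - γ)) ~[𝓝[>] 0]
      (fun γ : ℝ => systemConstDep P A K α N ^ (1 / α) * γ ^ (-1 / α)) := by
  have hu : ∀ j, 0 < K j ^ (1 / α) := fun j => Real.rpow_pos_of_pos (hK j) _
  have hlim := tendsto_tail_exposure N hα hK hV hV0 hP hA hA0 hAα hindep
    (h.tendsto_seminorm hα hK hV hV0 hP)
  have hint : Integrable (fun ω => networkSeminorm N (A ω) (fun j => K j ^ (1 / α)) ^ α) P :=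
    integrable_networkSeminorm_rpow N hα hA hA0 hAα fun j => (hu j).le
  have hnn : ∀ ω, 0 ≤ networkSeminorm N (A ω) (fun j => K j ^ (1 / α)) ^ α := fun ω =>
    Real.rpow_nonneg (apply_nonneg _ _) _
  have hC : ∫ ω, networkSeminorm N (A ω) (fun j => K j ^ (1 / α)) ^ α ∂P =
      systemConstDep P A K α N := by
    refine integral_congr_ae (Eventually.of_forall fun ω => ?_)
    have hvec : (A ω * Matrix.diagonal fun j => K j ^ (1 / α)).mulVec 1 =
        (A ω).mulVec fun j => K j ^ (1 / α) := by
      ext i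
      simp [Matrix.mulVec, dotProduct]
    simp only [hvec, networkSeminorm_apply]
  rw [hC] at hlim
  refine VaR_isEquivalent_of_tail hα (hC ▸ integral_nonneg hnn) hlim fun h0 => ?_
  rw [← hC] at h0
  filter_upwards [(integral_eq_zero_iff_of_nonneg hnn hint).1 h0] with ω hω
  exact hN (A ω) (hA0 ω) _ hu ((Real.rpow_eq_zero (apply_nonneg _ _) hα.ne').1 hω) _

lemma row_eq_zero_of_mulVec_eq_zero {a : Matrix (Fin q) (Fin d) ℝ} (ha : ∀ i j, 0 ≤ a i j)
    {u : Fin d → ℝ} (hu : ∀ j, 0 < u j) {i : Fin q} (h : a.mulVec u i = 0) (v : Fin d → ℝ) :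
    a.mulVec v i = 0 := by
  simp only [Matrix.mulVec, dotProduct] at h ⊢
  have h1 := (Finset.sum_eq_zero_iff_of_nonneg
    fun j _ => mul_nonneg (ha i j) (hu j).le).1 h
  refine Finset.sum_eq_zero fun j hj => ?_
  rw [(mul_eq_zero.1 (h1 j hj)).resolve_right (hu j).ne', zero_mul]

/-- The absolute value of the `i`-th coordinate, as a seminorm. It turns the claim about a single
agent into a case of the claim about the whole market. -/
noncomputable def coordSeminorm (i : Fin q) : Seminorm ℝ (Fin q → ℝ) :=
  (normSeminorm ℝ ℝ).comp (LinearMap.proj i)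

lemma coordSeminorm_apply (i : Fin q) (x : Fin q → ℝ) : coordSeminorm i x = |x i| := rfl

lemma measurable_weightedAdjacency {edge : Fin q → Fin d → Set Ω}
    (hedge : ∀ i j, MeasurableSet (edge i j)) {W : Fin q → Fin d → Ω → ℝ}
    (hW : ∀ i j, Measurable (W i j)) :
    Measurable fun ω i j => weightedAdjacency edge W ω i j :=
  measurable_pi_lambda _ fun i => measurable_pi_lambda _ fun j => (hW i j).indicator (hedge i j)

end Network

end ReinsuranceMarket

theorem corollary3p7 {Ω : Type*} [MeasurableSpace Ω] (P : Measure Ω) [IsProbabilityMeasure P]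
    {q d : ℕ} (α : ℝ) (hα : 0 < α)
    -- the norm on `ℝ^q`
    (N : Seminorm ℝ (Fin q → ℝ)) (hN : IsNormalizedNorm N)
    -- the claims
    (K : Fin d → ℝ) (hK : ∀ j, 0 < K j)
    (V : Ω → Fin d → ℝ) (hV : Measurable V) (hV0 : ∀ ω j, 0 ≤ V ω j)
    (hPareto : HasParetoTails P V K α)
    -- the random bipartite graph and its weights
    (edge : Fin q → Fin d → Set Ω) (hedge : ∀ i j, MeasurableSet (edge i j))
    (W : Fin q → Fin d → Ω → ℝ) (hW : ∀ i j, Measurable (W i j)) (hW0 : ∀ i j ω, 0 ≤ W i j ω)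
    (A : Ω → Matrix (Fin q) (Fin d) ℝ) (hA : A = weightedAdjacency edge W)
    (hAα : ∀ i j, Integrable (fun ω => (A ω i j) ^ α) P)
    (hindep : IndepFun V (fun ω i j => A ω i j) P)
    -- the exposures
    (F : Ω → Fin q → ℝ) (hF : F = exposure A V) :
    (AsymptoticallyIndependent P V α →
      (∀ i, (fun γ : ℝ => VaR P (fun ω => F ω i) (1 - γ)) ~[𝓝[>] 0]
        (fun γ : ℝ => individualConstInd P A K α i ^ (1 / α) * γ ^ (-1 / α))) ∧
      (fun γ : ℝ => VaR P (fun ω => N (F ω)) (1 - γ)) ~[𝓝[>] 0]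
        (fun γ : ℝ => systemConstInd P A K α N ^ (1 / α) * γ ^ (-1 / α))) ∧
    (AsymptoticallyFullyDependent P V K α →
      (∀ i, (fun γ : ℝ => VaR P (fun ω => F ω i) (1 - γ)) ~[𝓝[>] 0]
        (fun γ : ℝ => individualConstDep P A K α i ^ (1 / α) * γ ^ (-1 / α))) ∧
      (fun γ : ℝ => VaR P (fun ω => N (F ω)) (1 - γ)) ~[𝓝[>] 0]
        (fun γ : ℝ => systemConstDep P A K α N ^ (1 / α) * γ ^ (-1 / α))) := by
  have hAm : Measurable fun ω i j => A ω i j := hA ▸ measurable_weightedAdjacency hedge hW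
  have hA0 : ∀ ω i j, 0 ≤ A ω i j := fun ω i j => by
    rw [hA]
    exact Set.indicator_nonneg (fun ω _ => hW0 i j ω) ω
  have hF0 : ∀ ω i, coordSeminorm i (exposure A V ω) = F ω i := fun ω i => by
    rw [hF, coordSeminorm_apply]
    exact abs_of_nonneg (mulVec_apply_nonneg (hA0 ω i) (hV0 ω))
  refine ⟨fun h => ⟨fun i => ?_, ?_⟩, fun h => ⟨fun i => ?_, ?_⟩⟩
  · have h1 := VaR_exposure_of_independent (coordSeminorm i) hα hK hV hV0 hPareto hAm hA0 hAα
      hindep h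
    have hC : systemConstInd P A K α (coordSeminorm i) = individualConstInd P A K α i := by
      simp only [systemConstInd, individualConstInd, coordSeminorm_apply, Matrix.mulVec_single_one,
        Matrix.col_apply, abs_of_nonneg (hA0 _ _ _)]
    simpa only [hF0, hC] using h1
  · rw [hF]
    exact VaR_exposure_of_independent N hα hK hV hV0 hPareto hAm hA0 hAα hindep h
  · have h1 := VaR_exposure_of_fullyDependent (coordSeminorm i)
      (fun a ha u hu h0 v => by
        rw [coordSeminorm_apply, abs_eq_zero] at h0 ⊢
        exact row_eq_zero_of_mulVec_eq_zero ha hu h0 v)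
      hα hK hV hV0 hPareto hAm hA0 hAα hindep h
    have hC : systemConstDep P A K α (coordSeminorm i) = individualConstDep P A K α i := by
      refine integral_congr_ae (Eventually.of_forall fun ω => ?_)
      have hnn : 0 ≤ (A ω * Matrix.diagonal fun j => K j ^ (1 / α)).mulVec 1 i := by
        simp only [Matrix.mulVec, dotProduct, Matrix.mul_diagonal, Pi.one_apply, mul_one]
        exact Finset.sum_nonneg fun j _ =>
          mul_nonneg (hA0 ω i j) (Real.rpow_nonneg (hK j).le _)
      simp only [coordSeminorm_apply, abs_of_nonneg hnn]
    simpa only [hF0, hC] using h1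
  · rw [hF]
    refine VaR_exposure_of_fullyDependent N (fun a ha u hu h0 v => ?_) hα hK hV hV0 hPareto hAm
      hA0 hAα hindep h
    have h1 := hN.1 _ h0
    have h2 : a.mulVec v = 0 := by
      ext i
      exact row_eq_zero_of_mulVec_eq_zero ha hu (congrFun h1 i) v
    rw [h2, map_zero]
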